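/- Let $F=\mathbb{F}_q$ be a finite field with $q$ elements and characteristic $p>3$. A subset $A$ of an abelian group is a Sidon set if, for all $a_1,a_2,a_3,a_4\in A$, $a_1-a_2=a_3-a_4$ implies $\{a_1,a_4\}=\{a_2,a_3\}$; a Sidon set in $\mathbb{F}_q\times\mathbb{F}_q$ is maximum if it has exactly $q$ elements. For $P,Q\in\mathbb{F}_q[x]$ write $(P,Q)=\{(P(t),Q(t)) : t\in\mathbb{F}_q\}\subseteq\mathbb{F}_q\times\mathbb{F}_q$. A polynomial $P\in\mathbb{F}_q[x]$ is Sidon if there is $Q\in\mathbb{F}_q[x]$ such that $(P,Q)$ is a maximum Sidon set. Let $r>2$ be a natural number. Then: (i) if $r\mid q-1$, then $x^r\in\mathbb{F}_q[x]$ is not Sidon; (ii) if $\gcd(r,q-1)=1$, then $x^r\in\mathbb{F}_q[x]$ is Sidon; (iii) for every natural number $k$ with $p-1\mid kr-1$ and every $Q\in\mathbb{F}_p[x]$, the set $(x^r,Q)\subseteq\mathbb{F}_p\times\mathbb{F}_p$ is a Sidon set if and only if the remainder of $Q(x^k)$ modulo $x^p-x$ is a quadratic polynomial, i.e. has degree exactly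 $2$. -/

import Mathlib

open Polynomial

/-- A subset `A` of an abelian group is a Sidon set if `a₁ - a₂ = a₃ - a₄` with all `aᵢ ∈ A`
forces `{a₁, a₄} = {a₂, a₃}`. -/
def IsSidonSet {G : Type*} [AddCommGroup G] (A : Set G) : Prop :=
  ∀ a₁ ∈ A, ∀ a₂ ∈ A, ∀ a₃ ∈ A, ∀ a₄ ∈ A, a₁ - a₂ = a₃ - a₄ → ({a₁, a₄} : Set G) = {a₂, a₃}

/-- The set `(P, Q) = {(P(x), Q(x)) : x ∈ F}` in `F × F`. -/
def polyPairSet {F : Type*} [Field F] (P Q : F[X]) : Set (F × F) :=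
  Set.range fun x : F => (P.eval x, Q.eval x)

/-- A maximum Sidon set in `F × F`, for a finite field `F`: a Sidon set with `|F|` elements. -/
def IsMaximumSidonSet {F : Type*} [Field F] [Fintype F] (A : Set (F × F)) : Prop :=
  IsSidonSet A ∧ A.ncard = Fintype.card F

/-- `P` is a Sidon polynomial over `F × F` if `(P, Q)` is a maximum Sidon set for some `Q`. -/
def IsSidonPolynomial {F : Type*} [Field F] [Fintype F] (P : F[X]) : Prop :=
  ∃ Q : F[X], IsMaximumSidonSet (polyPairSet P Q)

/-!
Over `F`, the set `(X ^ r, Q)` is controlled by the map `t ↦ t ^ r`. If `r ∣ q - 1`, multiplying by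
an element `ζ` of order `r` does not change `t ^ r`, so two such multiplications, by `ζ` and by
`ζ ^ 2`, already produce too many differences with first coordinate zero
(`not_isSidonPolynomial_X_pow`). If `r` is coprime to `q - 1`, the map is a bijection and
`Q = X ^ (2 * r)` gives the parabola (`isSidonPolynomial_X_pow`).

Over a prime field, when `t ↦ t ^ k` inverts `t ↦ t ^ r`, the set is the graph of the polynomial
`f` of degree less than `p` representing `Q (X ^ k)` (`polyPairSet_X_pow_eq_graph`). The graph of
`f` is Sidon exactly when `f` is planar, meaning that `x ↦ f (x + a) - f x` is injective for every
`a ≠ 0` (`isSidonSet_graph_iff`). The heart of the matter is that a planar function over `ZMod p`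
is quadratic (`degree_eq_two_of_planar`).

Let `g` be planar and let `m` be the least exponent with `S m = ∑ x, g x ^ m ≠ 0`. Expanding
`∑ x, ∑ y, (g x - g y) ^ (2 * m)` leaves only the middle term `± (2m choose m) * S m ^ 2`, while
planarity turns the double sum into `-∑ t, t ^ (2 * m)`, which vanishes for `0 < 2 * m < p - 1`.
Hence `S k = 0` whenever `2 * k < p - 1`, and `S m ^ 2` is a fixed constant if `2 * m = p - 1`.
All functions `f x + b * x` are planar along with `f`, so these power sums are polynomials in `b`
that vanish, respectively have constant square. Comparing coefficients of powers of `b` gives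
`∑ x, x ^ i * f x ^ j = 0` for `i + j < (p - 1) / 2`, and also for `i + j = (p - 1) / 2` when
`i ≠ 0`. Since `∑ x, P x` is minus the coefficient of `X ^ (p - 1)` if `P` has degree at most
`p - 1`, the case `j = 1` forces `n = deg f ≤ (p - 1) / 2`. If `n ≥ 3`, write `p - 1 = n * j + i`
with `i < n`; here `i ≠ n - 1` because `p` is prime, so `i + j < (p - 1) / 2`, but
`X ^ i * f ^ j` has degree exactly `p - 1`, a contradiction.
-/

/-! ### Sidon graphs and planar functions -/

theorem isSidonSet_graph_iff {G H : Type*} [AddCommGroup G] [AddCommGroup H] (f : G → H) :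
    IsSidonSet (Set.range fun x => (x, f x)) ↔
      ∀ a ≠ 0, Function.Injective fun x => f (x + a) - f x := by
  constructor
  · intro h a ha x y hxy
    have := h _ ⟨x + a, rfl⟩ _ ⟨x, rfl⟩ _ ⟨y + a, rfl⟩ _ ⟨y, rfl⟩
      (Prod.ext (by simp) (by simpa using hxy))
    have hy : ((y, f y) : G × H) ∈ ({(x, f x), (y + a, f (y + a))} : Set (G × H)) := by
      rw [← this]; simp
    rcases hy with hy | hy
    · exact (congrArg Prod.fst hy).symm
    · exact absurd (by simpa using congrArg Prod.fst hy) ha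
  · rintro h _ ⟨x₁, rfl⟩ _ ⟨x₂, rfl⟩ _ ⟨x₃, rfl⟩ _ ⟨x₄, rfl⟩ h'
    have h1 : x₁ - x₂ = x₃ - x₄ := congrArg Prod.fst h'
    have h2 : f x₁ - f x₂ = f x₃ - f x₄ := congrArg Prod.snd h'
    by_cases ha : x₁ - x₂ = 0
    · have e1 := sub_eq_zero.1 ha
      have e2 := sub_eq_zero.1 (h1 ▸ ha)
      subst e1 e2
      rfl
    · have e : x₂ = x₄ := h _ ha (by
        have e3 : x₄ + (x₁ - x₂) = x₃ := by rw [h1]; abel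
        simpa [e3] using h2)
      subst e
      have e' : x₁ = x₃ := by simpa using h1
      subst e'
      exact Set.pair_comm _ _

theorem injective_quadratic_sub {F : Type*} [Field F] (h2 : (2 : F) ≠ 0) {α : F} (hα : α ≠ 0)
    (β γ : F) {a : F} (ha : a ≠ 0) :
    Function.Injective fun x : F =>
      (α * (x + a) ^ 2 + β * (x + a) + γ) - (α * x ^ 2 + β * x + γ) := by
  intro x y hxy
  have : 2 * α * a * (x - y) = 0 := by linear_combination hxy
  simpa [h2, hα, ha, sub_eq_zero] using this

/-! ### Power sums of planar functions over a prime field -/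

section Planar

variable {p : ℕ} [Fact p.Prime]

theorem sum_pow_card_sub_one : ∑ t : ZMod p, t ^ (p - 1) = -1 := by
  have hp := (Fact.out : p.Prime).one_lt
  have h : ∀ t : ZMod p, t ^ (p - 1) = 1 - if t = 0 then 1 else 0 := by
    intro t
    by_cases ht : t = 0
    · have : p - 1 ≠ 0 := by omega
      simp [ht, this]
    · simp [ht, ZMod.pow_card_sub_one_eq_one ht]
  simp_rw [h]
  simp [Finset.sum_sub_distrib]

/-- For fixed `a = x - y ≠ 0` the inner sum runs over all of `ZMod p` exactly once, so the `p - 1`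
nonzero values of `a` contribute the same power sum each. -/
theorem sum_sum_sub_pow {g : ZMod p → ZMod p}
    (hg : ∀ a ≠ 0, Function.Injective fun x => g (x + a) - g x) {k : ℕ} (hk : k ≠ 0) :
    ∑ y, ∑ x, (g x - g y) ^ k = -∑ t : ZMod p, t ^ k := by
  have h1 : ∀ y, ∑ x, (g x - g y) ^ k = ∑ a, (g (y + a) - g y) ^ k := fun y =>
    (Equiv.sum_comp (Equiv.addLeft y) fun x => (g x - g y) ^ k).symm
  simp_rw [h1]
  rw [Finset.sum_comm]
  have h2 : ∀ a : ZMod p, ∑ y, (g (y + a) - g y) ^ k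
      = (∑ t : ZMod p, t ^ k) - if a = 0 then ∑ t : ZMod p, t ^ k else 0 := by
    intro a
    by_cases ha : a = 0
    · simp [ha, hk]
    · rw [if_neg ha, sub_zero]
      exact (Finite.injective_iff_bijective.1 (hg a ha)).sum_comp fun t => t ^ k
  simp_rw [h2]
  rw [Finset.sum_sub_distrib]
  simp

/-- Only the middle term of the binomial expansion survives. -/
theorem sum_sum_sub_pow_of_sum_pow_eq_zero {g : ZMod p → ZMod p} {m : ℕ}
    (h : ∀ k < m, ∑ x, g x ^ k = 0) :
    ∑ y, ∑ x, (g x - g y) ^ (2 * m) = (-1) ^ m * (2 * m).choose m * (∑ x, g x ^ m) ^ 2 := by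
  have h1 : ∀ y x, (g x - g y) ^ (2 * m) = ∑ j ∈ Finset.range (2 * m + 1),
      g x ^ j * ((-1) ^ (2 * m - j) * g y ^ (2 * m - j)) * (2 * m).choose j := by
    intro y x
    rw [sub_eq_add_neg, add_pow]
    refine Finset.sum_congr rfl fun j _ => ?_
    rw [neg_pow (g y)]
  simp_rw [h1]
  have h2 : ∀ y, ∑ x, ∑ j ∈ Finset.range (2 * m + 1),
      g x ^ j * ((-1) ^ (2 * m - j) * g y ^ (2 * m - j)) * ((2 * m).choose j : ZMod p)
      = ∑ j ∈ Finset.range (2 * m + 1), (∑ x, g x ^ j) *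
        ((-1) ^ (2 * m - j) * g y ^ (2 * m - j)) * (2 * m).choose j := by
    intro y
    rw [Finset.sum_comm]
    simp_rw [Finset.sum_mul]
  simp_rw [h2]
  rw [Finset.sum_comm]
  have h3 : ∀ j, ∑ y, (∑ x, g x ^ j) *
        ((-1) ^ (2 * m - j) * g y ^ (2 * m - j)) * ((2 * m).choose j : ZMod p)
      = (-1) ^ (2 * m - j) * (2 * m).choose j *
        ((∑ x, g x ^ j) * ∑ y, g y ^ (2 * m - j)) := by
    intro j
    simp_rw [Finset.mul_sum]
    exact Finset.sum_congr rfl fun y _ => by ring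
  simp_rw [h3]
  rw [Finset.sum_eq_single m]
  · rw [show 2 * m - m = m by omega]; ring
  · intro j hj hjm
    rcases lt_or_gt_of_ne hjm with hlt | hlt
    · rw [h j hlt]; ring
    · rw [h (2 * m - j) (by have := Finset.mem_range.1 hj; omega)]; ring
  · intro hm; exact absurd (Finset.mem_range.2 (by omega)) hm

theorem natCast_choose_ne_zero {k i : ℕ} (hk : k < p) (hi : i ≤ k) :
    (k.choose i : ZMod p) ≠ 0 := by
  rw [Ne, ZMod.natCast_eq_zero_iff]
  intro hd
  have h := Nat.choose_mul_factorial_mul_factorial hi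
  rw [mul_assoc] at h
  have := (Nat.Prime.dvd_factorial Fact.out).1 (hd.trans (Dvd.intro _ h))
  omega

theorem sum_pow_eq_zero_of_planar {g : ZMod p → ZMod p}
    (hg : ∀ a ≠ 0, Function.Injective fun x => g (x + a) - g x) (k : ℕ) (hk : 2 * k < p - 1) :
    ∑ x, g x ^ k = 0 := by
  induction k using Nat.strong_induction_on with
  | _ k ih =>
    rcases Nat.eq_zero_or_pos k with rfl | hpos
    · simp
    have h1 := sum_sum_sub_pow_of_sum_pow_eq_zero (g := g) (m := k)
      fun j hj => ih j hj (by omega)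
    rw [sum_sum_sub_pow hg (by omega), FiniteField.sum_pow_lt_card_sub_one (ZMod p) _
      (by rwa [ZMod.card]), neg_zero] at h1
    simpa [natCast_choose_ne_zero (p := p) (show 2 * k < p by omega) (show k ≤ 2 * k by omega)]
      using h1.symm

/-- At the first exponent not covered by `sum_pow_eq_zero_of_planar`, the square of the power sum
does not depend on the planar function. -/
theorem sum_pow_half_sq_of_planar {g : ZMod p → ZMod p}
    (hg : ∀ a ≠ 0, Function.Injective fun x => g (x + a) - g x) {m : ℕ} (hm : 2 * m = p - 1)
    (hm0 : m ≠ 0) :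
    (-1) ^ m * ((2 * m).choose m : ZMod p) * (∑ x, g x ^ m) ^ 2 = 1 := by
  rw [← sum_sum_sub_pow_of_sum_pow_eq_zero fun k hk =>
    sum_pow_eq_zero_of_planar hg k (by omega), sum_sum_sub_pow hg (by omega), hm]
  rw [sum_pow_card_sub_one, neg_neg]

/-- `∑ x, (f x + b x) ^ k`, as a polynomial in `b`. -/
noncomputable def shearedPowerSum (f : ZMod p → ZMod p) (k : ℕ) : (ZMod p)[X] :=
  ∑ i ∈ Finset.range (k + 1), C (k.choose i * ∑ x, x ^ i * f x ^ (k - i)) * X ^ i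

theorem eval_shearedPowerSum (f : ZMod p → ZMod p) (k : ℕ) (b : ZMod p) :
    (shearedPowerSum f k).eval b = ∑ x, (f x + b * x) ^ k := by
  have h : ∀ x, (f x + b * x) ^ k = ∑ i ∈ Finset.range (k + 1),
      k.choose i * (x ^ i * f x ^ (k - i)) * b ^ i := by
    intro x
    rw [add_comm, add_pow]
    exact Finset.sum_congr rfl fun i _ => by ring
  simp_rw [h]
  rw [Finset.sum_comm, shearedPowerSum, eval_finsetSum]
  refine Finset.sum_congr rfl fun i _ => ?_
  rw [eval_mul, eval_C, eval_pow, eval_X, Finset.mul_sum, Finset.sum_mul]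

theorem coeff_shearedPowerSum (f : ZMod p → ZMod p) {k i : ℕ} (hi : i ≤ k) :
    (shearedPowerSum f k).coeff i = k.choose i * ∑ x, x ^ i * f x ^ (k - i) := by
  simp only [shearedPowerSum, finsetSum_coeff, coeff_C_mul, coeff_X_pow]
  rw [Finset.sum_eq_single i]
  · simp
  · intro j _ hj; simp [hj.symm]
  · intro h; exact absurd (Finset.mem_range.2 (by omega)) h

theorem natDegree_shearedPowerSum_le (f : ZMod p → ZMod p) (k : ℕ) :
    (shearedPowerSum f k).natDegree ≤ k :=
  natDegree_sum_le_of_forall_le _ _ fun i hi =>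
    (natDegree_C_mul_X_pow_le _ _).trans (by have := Finset.mem_range.1 hi; omega)

theorem planar_add_mul {f : ZMod p → ZMod p}
    (hf : ∀ a ≠ 0, Function.Injective fun x => f (x + a) - f x) (b : ZMod p) :
    ∀ a ≠ 0, Function.Injective fun x => (f (x + a) + b * (x + a)) - (f x + b * x) := by
  intro a ha x y hxy
  refine hf a ha ?_
  simp only at hxy ⊢
  linear_combination hxy

theorem eq_C_of_forall_eval_eq {P : (ZMod p)[X]} (hP : P.natDegree < p) (c : ZMod p)
    (h : ∀ b, P.eval b = c) : P = C c := by
  refine eq_of_natDegree_lt_card_of_eval_eq P (C c) (f := fun b : ZMod p => b)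
    Function.injective_id (by simpa using h) ?_
  simpa [ZMod.card, (Fact.out : p.Prime).pos] using hP

theorem sum_pow_mul_pow_eq_zero_of_planar {f : ZMod p → ZMod p}
    (hf : ∀ a ≠ 0, Function.Injective fun x => f (x + a) - f x) {i j : ℕ}
    (hij : 2 * (i + j) < p - 1) : ∑ x, x ^ i * f x ^ j = 0 := by
  have h := eq_C_of_forall_eval_eq (P := shearedPowerSum f (i + j))
    ((natDegree_shearedPowerSum_le f _).trans_lt (by omega)) 0 fun b => by
      rw [eval_shearedPowerSum]
      exact sum_pow_eq_zero_of_planar (planar_add_mul hf b) _ hij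
  have h2 := coeff_shearedPowerSum f (show i ≤ i + j by omega)
  rw [h, C_0, coeff_zero, add_tsub_cancel_left] at h2
  simpa [natCast_choose_ne_zero (p := p) (show i + j < p by omega) (show i ≤ i + j by omega)]
    using h2.symm

/-- The boundary case `i + j = (p - 1) / 2`: the square of `shearedPowerSum f (i + j)` has degree
less than `p` and is constant on `ZMod p`, so `shearedPowerSum f (i + j)` is constant too. -/
theorem sum_pow_mul_pow_eq_zero_of_planar_of_eq {f : ZMod p → ZMod p}
    (hf : ∀ a ≠ 0, Function.Injective fun x => f (x + a) - f x) {i j : ℕ}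
    (hij : 2 * (i + j) = p - 1) (hi : i ≠ 0) : ∑ x, x ^ i * f x ^ j = 0 := by
  have hP := natDegree_shearedPowerSum_le f (i + j)
  set P := shearedPowerSum f (i + j) with hPdef
  have hp := (Fact.out : p.Prime).pos
  have h := eq_C_of_forall_eval_eq (P := P ^ 2)
    (c := ((-1) ^ (i + j) * ((2 * (i + j)).choose (i + j) : ZMod p))⁻¹)
    (by rw [natDegree_pow]; omega) fun b => by
      rw [eval_pow, hPdef, eval_shearedPowerSum]
      exact (DivisionMonoid.inv_eq_of_mul _ _
        (sum_pow_half_sq_of_planar (planar_add_mul hf b) hij (by omega))).symm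
  have hd : P.natDegree = 0 := by
    have := congrArg natDegree h
    rw [natDegree_pow, natDegree_C] at this
    omega
  have h2 := coeff_shearedPowerSum f (show i ≤ i + j by omega)
  rw [← hPdef, coeff_eq_zero_of_natDegree_lt (by omega), add_tsub_cancel_left] at h2
  simpa [natCast_choose_ne_zero (p := p) (show i + j < p by omega) (show i ≤ i + j by omega)]
    using h2.symm

/-! ### Planar functions over a prime field are quadratic -/

theorem sum_eval_eq_neg_coeff {P : (ZMod p)[X]} (hP : P.natDegree ≤ p - 1) :
    ∑ x, P.eval x = -P.coeff (p - 1) := by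
  have hp := (Fact.out : p.Prime).one_lt
  simp_rw [eval_eq_sum_range' (show P.natDegree < p - 1 + 1 by omega)]
  rw [Finset.sum_comm, Finset.sum_range_succ, Finset.sum_eq_zero]
  · rw [← Finset.mul_sum, sum_pow_card_sub_one]
    ring
  · intro i hi
    rw [← Finset.mul_sum, FiniteField.sum_pow_lt_card_sub_one (ZMod p) _
      (by rw [ZMod.card]; exact Finset.mem_range.1 hi), mul_zero]

/-- The exponents `i` with `i + 1 ≤ (p - 1) / 2` in the vanishing of `∑ x, x ^ i * f x` kill the
coefficients of `f` from degree `p - 1` down to `(p + 1) / 2`. -/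
theorem natDegree_le_half_of_planar (hp : 3 < p) {f : (ZMod p)[X]} (hdeg : f.natDegree < p)
    (hf : ∀ a ≠ 0, Function.Injective fun x => f.eval (x + a) - f.eval x) :
    2 * f.natDegree ≤ p - 1 := by
  by_contra! hlt
  have hodd : p % 2 = 1 := (Nat.Prime.eq_two_or_odd Fact.out).resolve_left (by omega)
  set i := p - 1 - f.natDegree with hi
  have h0 : ∑ x, x ^ i * f.eval x ^ 1 = 0 := by
    rcases Nat.lt_or_ge (2 * (i + 1)) (p - 1) with h | h
    · exact sum_pow_mul_pow_eq_zero_of_planar hf h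
    · exact sum_pow_mul_pow_eq_zero_of_planar_of_eq hf (by omega) (by omega)
  have h1 := sum_eval_eq_neg_coeff (P := X ^ i * f)
    (natDegree_mul_le.trans (by rw [natDegree_X_pow]; omega))
  have h2 : p - 1 = f.natDegree + i := by omega
  rw [h2, coeff_X_pow_mul, coeff_natDegree] at h1
  simp only [eval_mul, eval_pow, eval_X, pow_one] at h0 h1
  rw [h0, eq_comm, neg_eq_zero, leadingCoeff_eq_zero] at h1
  simp [h1] at hlt

theorem degree_eq_two_of_planar (hp : 3 < p) {f : (ZMod p)[X]} (hdeg : f.natDegree < p)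
    (hf : ∀ a ≠ 0, Function.Injective fun x => f.eval (x + a) - f.eval x) :
    f.degree = 2 := by
  have hhalf := natDegree_le_half_of_planar hp hdeg hf
  set n := f.natDegree with hn
  have hn2 : 2 ≤ n := by
    by_contra! hlt
    have h := hf 1 one_ne_zero (a₁ := 0) (a₂ := 1) (by
      rw [eq_X_add_C_of_natDegree_le_one (show f.natDegree ≤ 1 by omega)]
      simp
      ring)
    exact zero_ne_one h
  rcases hn2.eq_or_lt with h2 | h3
  · rw [degree_eq_natDegree (by rintro rfl; simp at hn; omega), ← hn, ← h2]; rfl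
  exfalso
  -- Writing `p - 1 = n * j + i`, the polynomial `X ^ i * f ^ j` has degree exactly `p - 1`.
  set i := (p - 1) % n with hi
  set j := (p - 1) / n with hj
  have hdiv : n * j + i = p - 1 := Nat.div_add_mod _ _
  have hin : i < n := Nat.mod_lt _ (by omega)
  have hin' : i ≠ n - 1 := by
    -- otherwise `n` would be a proper divisor of the prime `p`
    intro h
    have hd : n ∣ p := ⟨j + 1, by rw [mul_add]; omega⟩
    rcases (Nat.dvd_prime Fact.out).1 hd with h' | h' <;> omega
  have hlt : 2 * (i + j) < p - 1 := by
    have h4 : i + 2 ≤ n := by omega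
    -- `n * (i + j) = (n - 1) * i + (p - 1)`, where `i ≤ n - 2` and `n ≤ (p - 1) / 2`
    generalize p - 1 = N at hdiv hhalf
    by_contra! hle
    zify at *
    nlinarith [mul_le_mul_of_nonneg_left hle (show (0 : ℤ) ≤ n by omega),
      mul_nonneg (show (0 : ℤ) ≤ n - 2 by omega) (sub_nonneg.2 hhalf),
      mul_nonneg (show (0 : ℤ) ≤ n - 1 by omega) (sub_nonneg.2 h4)]
  have h0 := sum_pow_mul_pow_eq_zero_of_planar (f := fun x => f.eval x) hf hlt
  have hd : (X ^ i * f ^ j).natDegree = p - 1 := by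
    have hf0 : f ≠ 0 := by rintro rfl; simp at hn; omega
    rw [natDegree_mul (by simp) (pow_ne_zero _ hf0), natDegree_X_pow, natDegree_pow, ← hn,
      ← hdiv]
    ring
  have h1 := sum_eval_eq_neg_coeff hd.le
  simp only [eval_mul, eval_pow, eval_X] at h1
  rw [h0, ← hd, coeff_natDegree, eq_comm, neg_eq_zero, leadingCoeff_eq_zero] at h1
  rw [h1] at hd
  simp at hd
  omega

theorem isSidonSet_graph_eval_iff (hp : 3 < p) {f : (ZMod p)[X]} (hdeg : f.natDegree < p) :
    IsSidonSet (Set.range fun x => (x, f.eval x)) ↔ f.degree = 2 := by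
  rw [isSidonSet_graph_iff fun x => f.eval x]
  refine ⟨degree_eq_two_of_planar hp hdeg, fun h a ha => ?_⟩
  have h2 : (2 : ZMod p) ≠ 0 := by
    intro h
    have := (ZMod.natCast_eq_zero_iff 2 p).1 (by exact_mod_cast h)
    exact absurd (Nat.le_of_dvd (by norm_num) this) (by omega)
  have hlead : f.coeff 2 ≠ 0 := by
    rw [← natDegree_eq_of_degree_eq_some h]
    exact leadingCoeff_ne_zero.2 (by rintro rfl; simp at h)
  rw [eq_quadratic_of_degree_le_two h.le]
  simpa using injective_quadratic_sub h2 hlead (f.coeff 1) (f.coeff 0) ha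

end Planar

/-! ### Monomials over a finite field -/

section Monomials

variable {F : Type*} [Field F] [Fintype F]

/-- If `ζ` has order `r` and `(X ^ r, Q)` were a maximum Sidon set, then `t ↦ Q (ζ t) - Q t` would
be a bijection of the nonzero elements whose values avoid those of `t ↦ Q (ζ ^ 2 t) - Q t`, which
are nonzero too. -/
theorem not_isSidonPolynomial_X_pow {r : ℕ} (hr : 2 < r) (hdvd : r ∣ Fintype.card F - 1) :
    ¬ IsSidonPolynomial (X ^ r : F[X]) := by
  classical
  rintro ⟨Q, hS, hcard⟩
  obtain ⟨ζ, hζ⟩ : ∃ ζ : Fˣ, orderOf ζ = r := by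
    obtain ⟨g, hg⟩ := IsCyclic.exists_ofOrder_eq_natCard (α := Fˣ)
    rw [Nat.card_eq_fintype_card, Fintype.card_units] at hg
    refine ⟨g ^ (orderOf g / r), orderOf_pow_orderOf_div (orderOf_pos g).ne' (hg ▸ hdvd)⟩
  have hζ1 : ζ ≠ 1 := by rintro rfl; simp at hζ; omega
  have hζ2 : ζ ^ 2 ≠ 1 := fun h => by
    have := Nat.le_of_dvd two_pos (orderOf_dvd_of_pow_eq_one h); omega
  have hζr : ζ ^ r = 1 := hζ ▸ pow_orderOf_eq_one ζ
  set φ : F → F × F := fun t => (t ^ r, Q.eval t) with hφ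
  have hset : polyPairSet (X ^ r) Q = Set.range φ := by simp [polyPairSet, hφ]
  rw [hset] at hS hcard
  have hinj : Function.Injective φ := by
    rw [← Set.injOn_univ, ← Set.ncard_image_iff, Set.image_univ, hcard, Set.ncard_univ,
      Nat.card_eq_fintype_card]
  have key : ∀ z z' t t' : Fˣ, z ^ r = 1 → z' ^ r = 1 → z ≠ 1 →
      Q.eval (z * t : F) - Q.eval (t : F) = Q.eval (z' * t' : F) - Q.eval (t' : F) →
      t = t' ∧ z = z' := by
    intro z z' t t' hz hz' hz1 h
    have hzF : (z : F) ^ r = 1 := by simpa using congrArg Units.val hz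
    have hzF' : (z' : F) ^ r = 1 := by simpa using congrArg Units.val hz'
    have := hS _ ⟨(z * t : F), rfl⟩ _ ⟨(t : F), rfl⟩ _ ⟨(z' * t' : F), rfl⟩ _ ⟨(t' : F), rfl⟩
      (Prod.ext (by simp [hφ, mul_pow, hzF, hzF']) h)
    have h1 : φ t ∈ ({φ (z * t), φ t'} : Set (F × F)) := by rw [this]; simp
    have h2 : φ (z * t) ∈ ({φ t, φ (z' * t')} : Set (F × F)) := by rw [← this]; simp
    have hne : (z * t : F) ≠ t := fun h => hz1 (by
      have : z * t = t := Units.ext h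
      simpa using this)
    have h3 : t = t' := by
      rcases h1 with h1 | h1
      · exact absurd (hinj h1).symm hne
      · exact Units.ext (hinj h1)
    refine ⟨h3, ?_⟩
    subst h3
    rcases h2 with h2 | h2
    · exact absurd (hinj h2) hne
    · have : z * t = z' * t := Units.ext (hinj h2)
      simpa using this
  have hne0 : ∀ z t : Fˣ, z ^ r = 1 → z ≠ 1 → Q.eval (z * t : F) - Q.eval (t : F) ≠ 0 := by
    intro z t hz hz1 h
    exact hz1 (key z 1 t t hz (one_pow r) hz1 (by simpa using h)).2
  set ψ : Fˣ → Fˣ := fun t => Units.mk0 _ (hne0 ζ t hζr hζ1)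
  have hψ : Function.Surjective ψ := Finite.injective_iff_surjective.1 fun t t' h =>
    (key ζ ζ t t' hζr hζr hζ1 (congrArg Units.val h)).1
  have hζ2r : (ζ ^ 2) ^ r = 1 := by rw [pow_right_comm, hζr, one_pow]
  obtain ⟨t, ht⟩ := hψ (Units.mk0 _ (hne0 (ζ ^ 2) 1 hζ2r hζ2))
  have := (key ζ (ζ ^ 2) t 1 hζr hζ2r hζ1 (congrArg Units.val ht)).2
  rw [pow_two] at this
  exact hζ1 (by simpa using this)

theorem bijective_pow_of_coprime {r : ℕ} (hr : r ≠ 0) (h : r.Coprime (Fintype.card F - 1)) :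
    Function.Bijective fun t : F => t ^ r := by
  classical
  rw [← Finite.injective_iff_bijective]
  intro t u htu
  simp only at htu
  by_cases ht : t = 0
  · subst ht
    rw [zero_pow hr] at htu
    exact (eq_zero_of_pow_eq_zero htu.symm : u = 0).symm
  have hu : u ≠ 0 := by
    rintro rfl
    rw [zero_pow hr] at htu
    exact ht (eq_zero_of_pow_eq_zero htu)
  have hc : (Nat.card Fˣ).Coprime r := by
    rw [Nat.card_eq_fintype_card, Fintype.card_units]
    exact h.symm
  have := (powCoprime hc).injective (a₁ := Units.mk0 t ht) (a₂ := Units.mk0 u hu)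
    (Units.ext (by simpa using htu))
  exact congrArg Units.val this

/-- The set `(X ^ r, X ^ (2 * r))` is the parabola, because `t ↦ t ^ r` is onto. -/
theorem isSidonPolynomial_X_pow (h2 : (2 : F) ≠ 0) {r : ℕ} (hr : r ≠ 0)
    (h : r.Coprime (Fintype.card F - 1)) : IsSidonPolynomial (X ^ r : F[X]) := by
  have hset : polyPairSet (X ^ r) (X ^ (r * 2)) = Set.range fun s : F => (s, s ^ 2) := by
    rw [← (bijective_pow_of_coprime hr h).surjective.range_comp]
    simp [polyPairSet, Function.comp_def, pow_mul]
  refine ⟨X ^ (r * 2), ?_, ?_⟩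
  · rw [hset, isSidonSet_graph_iff fun s : F => s ^ 2]
    intro a ha
    simpa using injective_quadratic_sub h2 one_ne_zero 0 0 ha
  · rw [hset, ← Set.image_univ, Set.ncard_image_of_injective _ fun s t hst =>
      congrArg Prod.fst hst, Set.ncard_univ, Nat.card_eq_fintype_card]

end Monomials

/-- When `t ↦ t ^ k` inverts `t ↦ t ^ r`, the set `(X ^ r, Q)` is the graph of the reduction of
`Q (X ^ k)` modulo `X ^ p - X`. -/
theorem polyPairSet_X_pow_eq_graph {p : ℕ} [Fact p.Prime] (hp : 3 < p) {r k : ℕ}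
    (hk : (p : ℤ) - 1 ∣ (k : ℤ) * (r : ℤ) - 1) (Q : (ZMod p)[X]) :
    polyPairSet (X ^ r) Q =
      Set.range fun s => (s, ((Q.comp (X ^ k)) %ₘ (X ^ p - X)).eval s) := by
  have hkr : k * r ≠ 0 := by
    intro h
    have h0 : (k : ℤ) * r = 0 := by exact_mod_cast h
    rw [h0] at hk
    have := Int.le_of_dvd one_pos ((dvd_neg (b := (1 : ℤ))).1 (by simpa using hk))
    omega
  obtain ⟨c, hc⟩ : p - 1 ∣ k * r - 1 := by
    have e1 : ((p - 1 : ℕ) : ℤ) = (p : ℤ) - 1 := by push_cast [show 1 ≤ p by omega]; ring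
    have e2 : ((k * r - 1 : ℕ) : ℤ) = (k : ℤ) * r - 1 := by
      push_cast [Nat.one_le_iff_ne_zero.2 hkr]; ring
    rw [← Int.natCast_dvd_natCast, e1, e2]
    exact hk
  have hpow : ∀ t : ZMod p, t ^ (k * r) = t := by
    intro t
    by_cases ht : t = 0
    · rw [ht, zero_pow hkr]
    · rw [show k * r = (p - 1) * c + 1 by omega, pow_succ, pow_mul,
        ZMod.pow_card_sub_one_eq_one ht, one_pow, one_mul]
  have heval : ∀ s, ((Q.comp (X ^ k)) %ₘ (X ^ p - X)).eval s = Q.eval (s ^ k) := by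
    intro s
    rw [← eval₂_id, eval₂_modByMonic_eq_self_of_root (by simp), eval₂_id]
    simp
  have hsurj : Function.Surjective fun s : ZMod p => s ^ k := fun t =>
    ⟨t ^ r, by simp only [← pow_mul, mul_comm r k, hpow]⟩
  simp_rw [heval]
  rw [polyPairSet, ← hsurj.range_comp]
  simp [Function.comp_def, ← pow_mul, hpow]

theorem mainTheorem4 {F : Type*} [Field F] [Fintype F] (p : ℕ) [Fact p.Prime] [CharP F p]
    (hp : 3 < p) (r : ℕ) (hr : 2 < r) :
    (r ∣ Fintype.card F - 1 → ¬ IsSidonPolynomial (X ^ r : F[X])) ∧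
    (Nat.Coprime r (Fintype.card F - 1) → IsSidonPolynomial (X ^ r : F[X])) ∧
    (∀ k : ℕ, (p : ℤ) - 1 ∣ (k : ℤ) * (r : ℤ) - 1 → ∀ Q : (ZMod p)[X],
      (IsSidonSet (polyPairSet (X ^ r) Q) ↔
        ((Q.comp (X ^ k)) %ₘ (X ^ p - X)).degree = 2)) := by
  refine ⟨not_isSidonPolynomial_X_pow hr, isSidonPolynomial_X_pow ?_ (by omega), ?_⟩
  · intro h
    have := (CharP.cast_eq_zero_iff F p 2).1 (by exact_mod_cast h)
    exact absurd (Nat.le_of_dvd (by norm_num) this) (by omega)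
  · intro k hk Q
    rw [polyPairSet_X_pow_eq_graph hp hk Q]
    refine isSidonSet_graph_eval_iff hp ?_
    have hdeg : (X ^ p - X : (ZMod p)[X]).natDegree = p :=
      FiniteField.X_pow_card_sub_X_natDegree_eq _ (by omega)
    have hmonic : (X ^ p - X : (ZMod p)[X]).Monic :=
      monic_X_pow_sub (by rw [degree_X]; exact_mod_cast (by omega : 1 < p))
    exact (natDegree_modByMonic_lt _ hmonic fun h => by
      rw [h, natDegree_one] at hdeg; omega).trans_eq hdeg
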